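/- For $p\in(1,2)$ let $\mathcal D_p$ denote the standard $p$-stable distribution, i.e. the probability distribution on $\mathbb R$ with characteristic function $t\mapsto e^{-|t|^p}$. For real random variables $X,Y$ write $X\succeq Y$ if $\Pr[X\ge t]\ge\Pr[Y\ge t]$ for all $t\in\mathbb R$. For every $p\in(1,2)$ there exist constants $\alpha_p>0$ and $\beta_p>0$, depending only on $p$, such that the following hold. (1) If $C$ is a standard Cauchy variable, $X_p\sim\mathcal D_p$, and $G$ is a standard Gaussian variable (mean $0$, variance $1$), then $$\alpha_p|C|\succeq|X_p|^p\succeq\beta_p|G|^2 .$$ (2) (Upper tail.) Let $m\ge 3$, let $X_1,\dots,X_m$ be (not necessarily independent) random variables on a common probability space, each with distribution $\mathcal D_p$, let $\gamma_1,\dots,\gamma_m>0$ and $\gamma=\sum_i\gamma_i$. Then for every $t\ge 1$, $$\Pr\Big[\sum_{i=1}^m\gamma_i|X_i|^p\ge t\,\alpha_p\,\gamma\Big]\le\frac{2\log(mt)}{t}.$$ (3) (Lower tail.) Let $X_1,\dots,X_m$ be independent random variables with distribution $\mathcal D_p$, let $\gamma_1,\dots,\gamma_m\ge 0$, not all zero,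 and $\gamma=\sum_i\gamma_i$. Then for every $t>0$, with the convention $\log 0=-\infty$, $$\log\Pr\Big[\sum_{i=1}^m\gamma_i|X_i|^p\le(1-t)\,\beta_p\,\gamma\Big]\le\frac{-\gamma t^2}{6\max_i\gamma_i}.$$ -/

import Mathlib

open MeasureTheory ProbabilityTheory

/-- `D` is the standard `p`-stable distribution: the probability measure on `ℝ` with
characteristic function `t ↦ exp (-|t| ^ p)`. -/
def IsStandardStable (p : ℝ) (D : Measure ℝ) : Prop :=
  IsProbabilityMeasure D ∧ ∀ t : ℝ, charFun D t = ((Real.exp (-|t| ^ p) : ℝ) : ℂ)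

/-- The stochastic order `X ⪰ Y` between real random variables, in terms of their laws `μ` of `X`
and `ν` of `Y`: `Pr[X ≥ t] ≥ Pr[Y ≥ t]` for all real `t`. -/
def StochDominates (μ ν : Measure ℝ) : Prop :=
  ∀ t : ℝ, ν (Set.Ici t) ≤ μ (Set.Ici t)

open scoped NNReal ENNReal

/-! Everything follows from crude two-sided bounds on the law of `|X|`, read off the characteristic
function. Since a Gaussian is its own Fourier transform up to scaling, Fubini turns the Gaussian
average `E exp(-v X²/2)` into an average of `exp(-|z|^p)` under `N(0, v)`. The latter is of order
`1/√v` for large `v`, which gives `Pr[|X| < s] ≍ s` for small `s`. At infinity, `1 - φ(t) ≤ |t|^p`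
gives `Pr[|X|^p ≥ u] = O(1/u)`. Conversely, as `p < 2`, `1 - φ(t) ≈ |t|^p` is too large near `0` to
come from bounded values of `X`, which forces a polynomial lower bound on the tail.

For (1), compare at both ends. Near `0`, `Pr[|X|^p < u]` is of order `u^(1/p)`, between the order
`u` of `|C|` and the order `√u` of `|G|²`. At infinity the Cauchy tail is also of order `1/u`, and
the Gaussian tail beats every power. Scaling absorbs the constants (`exists_stochDominates_cauchy`,
`exists_stochDominates_gaussian`).

The tail inequalities (2) and (3) do not use these comparisons. The upper tail needs only the
`O(1/u)` bound: truncate, then apply a union bound and Markov's inequality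
(`measureReal_sum_ge_le`). The lower tail needs only that `|X|^p` exceeds `2β` with probability at
least `1/2`: this bounds the Laplace transform, and Chernoff's method applies
(`measureReal_sum_le_le_exp`). -/

lemma Real.exp_neg_le_quadratic {x : ℝ} (hx : 0 ≤ x) : Real.exp (-x) ≤ 1 - x + x ^ 2 / 2 := by
  have h := Real.quadratic_le_exp_of_nonneg hx
  rw [Real.exp_neg]
  refine inv_le_of_inv_le₀ (by nlinarith [sq_nonneg (x - 1)]) ?_
  refine le_trans ?_ h
  rw [inv_le_iff_one_le_mul₀ (by nlinarith [sq_nonneg (x - 1)])]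
  nlinarith [sq_nonneg (x ^ 2)]

lemma integral_charFun_swap (μ ν : Measure ℝ) [IsFiniteMeasure μ] [IsFiniteMeasure ν] :
    ∫ x, charFun ν x ∂μ = ∫ z, charFun μ z ∂ν := by
  simp_rw [charFun_apply_real]
  rw [integral_integral_swap]
  · simp_rw [mul_comm]
  · refine Integrable.of_bound (C := 1) (by fun_prop) (ae_of_all _ fun z => ?_)
    simp only [Function.uncurry]
    rw [← Complex.ofReal_mul, Complex.norm_exp_ofReal_mul_I]

/-! ### Small-ball probabilities of stable laws, by Gaussian averaging. -/

namespace IsStandardStable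

variable {p : ℝ} {D : Measure ℝ}

lemma integral_exp_neg_mul_sq (hD : IsStandardStable p D) (v : ℝ≥0) :
    ∫ x, Real.exp (-(v * x ^ 2 / 2)) ∂D = ∫ z, Real.exp (-|z| ^ p) ∂(gaussianReal 0 v) := by
  have := hD.1
  have h := integral_charFun_swap D (gaussianReal 0 v)
  simp_rw [hD.2, charFun_gaussianReal] at h
  rw [← Complex.ofReal_inj, ← integral_complex_ofReal, ← integral_complex_ofReal, ← h]
  congr 1 with x
  simp

lemma integrable_exp_neg_abs_rpow (hp : 0 < p) :
    Integrable fun z : ℝ => Real.exp (-|z| ^ p) := by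
  apply Integrable.of_integral_ne_zero
  rw [integral_comp_abs (f := fun x => Real.exp (-x ^ p)), integral_exp_neg_rpow hp]
  have := Real.Gamma_pos_of_pos (show 0 < 1 / p + 1 by positivity)
  positivity

lemma integrable_exp_neg_abs_rpow_of_isFiniteMeasure {μ : Measure ℝ} [IsFiniteMeasure μ]
    (hp : 0 ≤ p) : Integrable (fun z : ℝ => Real.exp (-|z| ^ p)) μ := by
  refine Integrable.of_bound (C := 1) (by fun_prop (disch := assumption))
    (ae_of_all _ fun z => ?_)
  rw [Real.norm_of_nonneg (Real.exp_pos _).le]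
  exact Real.exp_le_one_iff.2 (neg_nonpos.2 (by positivity))

lemma exists_integral_exp_neg_mul_sq_le (hp : 0 < p) :
    ∃ C : ℝ, 0 < C ∧ ∀ D : Measure ℝ, IsStandardStable p D → ∀ v : ℝ≥0, 0 < v →
      ∫ x, Real.exp (-(v * x ^ 2 / 2)) ∂D ≤ C / √v := by
  have hI := integrable_exp_neg_abs_rpow hp
  have h0 : 0 ≤ ∫ z : ℝ, Real.exp (-|z| ^ p) := integral_nonneg fun _ => (Real.exp_pos _).le
  -- The Gaussian density is at most `1/√(2πv)`; the added `1` only makes the constant visibly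
  -- positive.
  refine ⟨(√(2 * Real.pi))⁻¹ * (1 + ∫ z : ℝ, Real.exp (-|z| ^ p)), by positivity,
    fun D hD v hv => ?_⟩
  rw [hD.integral_exp_neg_mul_sq, integral_gaussianReal_eq_integral_smul hv.ne']
  have hv' : (0 : ℝ) < v := hv
  calc ∫ z, gaussianPDFReal 0 v z • Real.exp (-|z| ^ p)
      ≤ ∫ z, (√(2 * Real.pi * v))⁻¹ * Real.exp (-|z| ^ p) := by
        refine integral_mono_of_nonneg (ae_of_all _ fun z => ?_) (hI.const_mul _)
          (ae_of_all _ fun z => ?_)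
        · exact smul_nonneg (gaussianPDFReal_nonneg _ _ _) (Real.exp_pos _).le
        · simp only [smul_eq_mul]
          gcongr
          rw [gaussianPDFReal]
          refine mul_le_of_le_one_right (by positivity) (Real.exp_le_one_iff.2 ?_)
          rw [neg_div]
          exact neg_nonpos.2 (by positivity)
    _ = (√(2 * Real.pi))⁻¹ * (∫ z : ℝ, Real.exp (-|z| ^ p)) / √v := by
        rw [integral_const_mul, Real.sqrt_mul (by positivity)]
        field_simp
    _ ≤ _ := by gcongr; linarith

lemma exists_le_gaussianReal_real_Ioo :
    ∃ c : ℝ, 0 < c ∧ ∀ v : ℝ≥0, 1 ≤ v → ∀ r : ℝ, 0 ≤ r → r ≤ 1 →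
      c * r / √v ≤ (gaussianReal 0 v).real (Set.Ioo (-r) r) := by
  refine ⟨(√(2 * Real.pi))⁻¹ * Real.exp (-1) * 2, by positivity, fun v hv r hr hr1 => ?_⟩
  have hv' : (1 : ℝ) ≤ v := hv
  have hv0 : v ≠ 0 := (zero_lt_one.trans_le hv).ne'
  rw [measureReal_def, gaussianReal_apply_eq_integral _ hv0, ENNReal.toReal_ofReal
    (integral_nonneg fun _ => gaussianPDFReal_nonneg _ _ _)]
  calc (√(2 * Real.pi))⁻¹ * Real.exp (-1) * 2 * r / √v
      = ∫ _ in Set.Ioo (-r) r, (√(2 * Real.pi * v))⁻¹ * Real.exp (-1) := by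
        rw [setIntegral_const, Real.volume_real_Ioo_of_le (by linarith),
          Real.sqrt_mul (x := 2 * Real.pi) (by positivity), smul_eq_mul, mul_inv]
        ring
    _ ≤ _ := by
        refine setIntegral_mono_on (integrableOn_const (by simp)) (integrable_gaussianPDFReal _ _).integrableOn
          measurableSet_Ioo fun x hx => ?_
        rw [gaussianPDFReal]
        gcongr
        have : x ^ 2 ≤ 1 := by nlinarith [hx.1, hx.2]
        rw [neg_div, sub_zero, neg_le_neg_iff, div_le_one (by positivity)]
        linarith

lemma exists_le_integral_exp_neg_mul_sq (hp : 0 < p) :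
    ∃ c : ℝ, 0 < c ∧ ∀ D : Measure ℝ, IsStandardStable p D → ∀ v : ℝ≥0, 1 ≤ v →
      c / √v ≤ ∫ x, Real.exp (-(v * x ^ 2 / 2)) ∂D := by
  obtain ⟨c, hc, h⟩ := exists_le_gaussianReal_real_Ioo
  refine ⟨Real.exp (-1) * c, by positivity, fun D hD v hv => ?_⟩
  rw [hD.integral_exp_neg_mul_sq]
  calc Real.exp (-1) * c / √v = Real.exp (-1) * (c * 1 / √v) := by ring
    _ ≤ Real.exp (-1) * (gaussianReal 0 v).real (Set.Ioo (-1) 1) := by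
        gcongr; exact h v hv 1 zero_le_one le_rfl
    _ = ∫ _ in Set.Ioo (-1 : ℝ) 1, Real.exp (-1) ∂(gaussianReal 0 v) := by
        rw [setIntegral_const, smul_eq_mul, mul_comm]
    _ ≤ ∫ z in Set.Ioo (-1 : ℝ) 1, Real.exp (-|z| ^ p) ∂(gaussianReal 0 v) := by
        refine setIntegral_mono_on (by simp) ?_ measurableSet_Ioo fun x hx => ?_
        · exact (integrable_exp_neg_abs_rpow_of_isFiniteMeasure hp.le).integrableOn
        · gcongr
          exact Real.rpow_le_one (abs_nonneg x) (abs_le.2 ⟨hx.1.le, hx.2.le⟩) hp.le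
    _ ≤ _ := by
        exact setIntegral_le_integral (integrable_exp_neg_abs_rpow_of_isFiniteMeasure hp.le)
          (ae_of_all _ fun _ => (Real.exp_pos _).le)

lemma integrable_exp_neg_mul_sq [IsFiniteMeasure D] (v : ℝ≥0) :
    Integrable (fun x : ℝ => Real.exp (-(v * x ^ 2 / 2))) D := by
  refine Integrable.of_bound (C := 1) (by fun_prop) (ae_of_all _ fun z => ?_)
  rw [Real.norm_of_nonneg (Real.exp_pos _).le]
  exact Real.exp_le_one_iff.2 (neg_nonpos.2 (by positivity))

/-- Small ball probabilities of a stable law are at most linear in the radius. -/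
lemma exists_measureReal_abs_lt_le (hp : 0 < p) :
    ∃ C : ℝ, 0 < C ∧ ∀ D : Measure ℝ, IsStandardStable p D → ∀ s : ℝ, 0 < s →
      D.real {x | |x| < s} ≤ C * s := by
  obtain ⟨C, hC, h⟩ := exists_integral_exp_neg_mul_sq_le hp
  refine ⟨Real.exp 1 * C, by positivity, fun D hD s hs => ?_⟩
  have := hD.1
  -- At `v = s⁻²` the weight `exp(-v x²/2)` is at least `exp(-1)` on the ball `|x| < s`.
  obtain ⟨v, hv⟩ : ∃ v : ℝ≥0, (v : ℝ) = s⁻¹ ^ 2 := ⟨⟨s⁻¹ ^ 2, by positivity⟩, rfl⟩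
  have h1 := h D hD v (by rw [← NNReal.coe_pos, hv]; positivity)
  have hm : MeasurableSet {x : ℝ | |x| < s} := measurableSet_lt (by fun_prop) (by fun_prop)
  have h2 : Real.exp (-1) * D.real {x | |x| < s} ≤
      ∫ x, Real.exp (-(v * x ^ 2 / 2)) ∂D := by
    calc Real.exp (-1) * D.real {x | |x| < s}
        = ∫ _ in {x | |x| < s}, Real.exp (-1) ∂D := by
          rw [setIntegral_const, smul_eq_mul, mul_comm]
      _ ≤ ∫ x in {x | |x| < s}, _ ∂D := by
          refine setIntegral_mono_on (by simp) (integrable_exp_neg_mul_sq _).integrableOn hm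
            fun x hx => ?_
          gcongr
          rw [hv]
          have : x ^ 2 ≤ s ^ 2 := sq_le_sq.2 (by rw [abs_of_pos hs]; exact le_of_lt hx)
          have h3 : s⁻¹ ^ 2 * x ^ 2 ≤ s⁻¹ ^ 2 * s ^ 2 := by gcongr
          have h4 : s⁻¹ ^ 2 * s ^ 2 = 1 := by field_simp
          linarith
      _ ≤ _ := setIntegral_le_integral (integrable_exp_neg_mul_sq _)
          (ae_of_all _ fun _ => (Real.exp_pos _).le)
  have h5 := h2.trans h1
  rw [hv, Real.sqrt_sq (by positivity), div_inv_eq_mul] at h5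
  calc D.real {x | |x| < s} = Real.exp 1 * (Real.exp (-1) * D.real {x | |x| < s}) := by
        rw [← mul_assoc, ← Real.exp_add]; simp
    _ ≤ Real.exp 1 * (C * s) := by gcongr
    _ = _ := by ring

/-- Small ball probabilities of a stable law are at least linear in the radius. -/
lemma exists_le_measureReal_abs_lt (hp : 0 < p) :
    ∃ c : ℝ, 0 < c ∧ ∀ D : Measure ℝ, IsStandardStable p D → ∀ s : ℝ, 0 < s → s ≤ 1 →
      c * s ≤ D.real {x | |x| < s} := by
  obtain ⟨C, hC, h⟩ := exists_integral_exp_neg_mul_sq_le hp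
  obtain ⟨c, hc, h'⟩ := exists_le_integral_exp_neg_mul_sq hp
  -- With `v = (A/s)²`, outside the ball half of the exponent contributes a factor at most
  -- `exp(-A²/4)`, and the other half is the average at `v/2`, at most `C√2/√v`. This `A` makes the
  -- outside contribution at most half of the lower bound `c/√v`, so the ball carries the other
  -- half.
  obtain ⟨A, hA1, hA⟩ : ∃ A : ℝ, 1 ≤ A ∧ Real.exp (-(A ^ 2 / 4)) * (C * √2) ≤ c / 2 := by
    have ht : Filter.Tendsto (fun A : ℝ => Real.exp (-(A ^ 2 / 4)) * (C * √2)) Filter.atTop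
        (nhds (0 * (C * √2))) := by
      refine Filter.Tendsto.mul_const _ (Real.tendsto_exp_neg_atTop_nhds_zero.comp ?_)
      exact (Filter.tendsto_pow_atTop two_ne_zero).atTop_div_const (by norm_num)
    rw [zero_mul] at ht
    exact ((Filter.eventually_ge_atTop 1).and (ht.eventually_le_const (by positivity))).exists
  refine ⟨c / 2 / A, by positivity, fun D hD s hs hs1 => ?_⟩
  have := hD.1
  have hA0 : 0 < A := by linarith
  obtain ⟨v, hv⟩ : ∃ v : ℝ≥0, (v : ℝ) = (A / s) ^ 2 := ⟨⟨(A / s) ^ 2, by positivity⟩, rfl⟩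
  have hAs : 1 ≤ A / s := (one_le_div hs).2 (hs1.trans hA1)
  have hv1 : 1 ≤ v := by
    rw [← NNReal.coe_le_coe, hv]; exact one_le_pow₀ hAs
  have hsq : √(v : ℝ) = A / s := by rw [hv, Real.sqrt_sq (by positivity)]
  have h1 := h' D hD v hv1
  have h2 := h D hD (v / 2) (by positivity)
  have h3 : ∫ x, Real.exp (-(v * x ^ 2 / 2)) ∂D ≤
      ∫ x, ({x | |x| < s}.indicator (fun _ => (1 : ℝ)) x +
        Real.exp (-(A ^ 2 / 4)) * Real.exp (-((v / 2 : ℝ≥0) * x ^ 2 / 2))) ∂D := by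
    have hm : MeasurableSet {x : ℝ | |x| < s} := measurableSet_lt (by fun_prop) (by fun_prop)
    refine integral_mono (integrable_exp_neg_mul_sq _)
      (((integrable_const 1).indicator hm).add ((integrable_exp_neg_mul_sq _).const_mul _))
      fun x => ?_
    by_cases hx : |x| < s
    · have : Real.exp (-(v * x ^ 2 / 2)) ≤ 1 :=
        Real.exp_le_one_iff.2 (neg_nonpos.2 (by positivity))
      simp only [Set.indicator, Set.mem_ofPred_eq, hx, if_true]
      have := Real.exp_pos (-(A ^ 2 / 4))
      have := Real.exp_pos (-((v / 2 : ℝ≥0) * x ^ 2 / 2))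
      nlinarith
    · simp only [Set.indicator, Set.mem_ofPred_eq, hx, if_false, zero_add]
      rw [← Real.exp_add]
      gcongr
      push_cast
      have hx2 : s ^ 2 ≤ x ^ 2 := sq_le_sq.2 (by rw [abs_of_pos hs]; exact not_lt.1 hx)
      have : A ^ 2 ≤ v * x ^ 2 := by
        calc A ^ 2 = v * s ^ 2 := by rw [hv]; field_simp
          _ ≤ _ := by gcongr
      linarith
  have hm : MeasurableSet {x : ℝ | |x| < s} := measurableSet_lt (by fun_prop) (by fun_prop)
  rw [integral_add ((integrable_const 1).indicator hm)
    ((integrable_exp_neg_mul_sq _).const_mul _), integral_const_mul, integral_indicator hm,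
    setIntegral_const, smul_eq_mul, mul_one] at h3
  have h4 : Real.exp (-(A ^ 2 / 4)) * ∫ x, Real.exp (-((v / 2 : ℝ≥0) * x ^ 2 / 2)) ∂D ≤
      c / 2 / √v := by
    calc _ ≤ Real.exp (-(A ^ 2 / 4)) * (C / √((v / 2 : ℝ≥0) : ℝ)) := by gcongr
      _ = Real.exp (-(A ^ 2 / 4)) * (C * √2) / √v := by
        push_cast; rw [Real.sqrt_div (by positivity)]; field_simp
      _ ≤ _ := by gcongr
  have h5 : c / √v - c / 2 / √v = c / 2 / A * s := by rw [hsq]; field_simp; ring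
  linarith

end IsStandardStable

/-! ### Upper tails of stable laws: bounds from above and from below. -/

namespace IsStandardStable

variable {p : ℝ} {D : Measure ℝ}

/-- The upper tail of `|X| ^ p` for a `p`-stable variable `X` decays at least like `1 / u`. -/
lemma measureReal_le_abs_rpow_le (hp : 0 < p) (hD : IsStandardStable p D) {u : ℝ} (hu : 0 < u) :
    D.real {x | u ≤ |x| ^ p} ≤ 2 * 4 ^ p / u := by
  have := hD.1
  -- Halving gives the strict inequality `r < |x|` that the characteristic-function tail bound
  -- requires.
  set r : ℝ := u ^ p⁻¹ / 2 with hr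
  have hr0 : 0 < r := by positivity
  have hsub : {x : ℝ | u ≤ |x| ^ p} ⊆ {x | r < |x|} := fun x hx => by
    have h1 : u ^ p⁻¹ ≤ |x| := by
      rw [Real.rpow_inv_le_iff_of_pos hu.le (abs_nonneg x) hp]; exact hx
    have : 0 < u ^ p⁻¹ := by positivity
    change r < |x|
    linarith
  have hint : ‖∫ t in (-2 * r⁻¹)..(2 * r⁻¹), 1 - charFun D t‖ ≤
      (2 * r⁻¹) ^ p * |2 * r⁻¹ - -2 * r⁻¹| := by
    refine intervalIntegral.norm_integral_le_of_norm_le_const fun t ht => ?_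
    have hlt : -2 * r⁻¹ ≤ 2 * r⁻¹ := by have := inv_pos.2 hr0; linarith
    rw [Set.uIoc_of_le hlt] at ht
    rw [hD.2, ← Complex.ofReal_one, ← Complex.ofReal_sub, Complex.norm_real,
      Real.norm_of_nonneg (sub_nonneg.2 (Real.exp_le_one_iff.2 (neg_nonpos.2 (by positivity))))]
    calc 1 - Real.exp (-|t| ^ p) ≤ |t| ^ p := by linarith [Real.add_one_le_exp (-|t| ^ p)]
      _ ≤ (2 * r⁻¹) ^ p := by
        gcongr
        exact abs_le.2 ⟨by linarith [ht.1], ht.2⟩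
  calc D.real {x | u ≤ |x| ^ p} ≤ D.real {x | r < |x|} := measureReal_mono hsub
    _ ≤ 2⁻¹ * r * ‖∫ t in (-2 * r⁻¹)..(2 * r⁻¹), 1 - charFun D t‖ :=
      measureReal_abs_gt_le_integral_charFun hr0
    _ ≤ 2⁻¹ * r * ((2 * r⁻¹) ^ p * |2 * r⁻¹ - -2 * r⁻¹|) := by gcongr
    _ = 2 * (2 * r⁻¹) ^ p := by
      rw [abs_of_pos (by have := inv_pos.2 hr0; linarith)]
      field_simp
      ring
    _ = 2 * 4 ^ p / u := by
      have : 2 * r⁻¹ = 4 / u ^ p⁻¹ := by rw [hr]; field_simp; norm_num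
      rw [this, Real.div_rpow (by norm_num) (by positivity), Real.rpow_inv_rpow hu.le hp.ne']
      ring

lemma integral_one_sub_cos (hD : IsStandardStable p D) (t : ℝ) :
    ∫ x, (1 - Real.cos (t * x)) ∂D = 1 - Real.exp (-|t| ^ p) := by
  have := hD.1
  have hcos : Integrable (fun x : ℝ => Real.cos (t * x)) D :=
    Integrable.of_bound (C := 1) (by fun_prop) (ae_of_all _ fun x => Real.abs_cos_le_one _)
  have hI : Integrable (fun x : ℝ => Complex.exp (t * x * Complex.I)) D := by
    refine Integrable.of_bound (C := 1) (by fun_prop) (ae_of_all _ fun x => ?_)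
    rw [← Complex.ofReal_mul, Complex.norm_exp_ofReal_mul_I]
  have h := congrArg Complex.re (hD.2 t)
  rw [charFun_apply_real, Complex.ofReal_re] at h
  have h2 := integral_re hI
  simp only [RCLike.re_eq_complex_re] at h2
  rw [integral_sub (integrable_const _) hcos, ← h, ← h2]
  simp only [← Complex.ofReal_mul, Complex.exp_ofReal_mul_I_re]
  simp

/-- The upper tail of `|X| ^ p` for a `p`-stable variable `X`, `p < 2`, decays at most
polynomially. -/
lemma exists_le_measureReal_le_abs_rpow (hp : p ∈ Set.Ioo (1 : ℝ) 2) :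
    ∃ c : ℝ, 0 < c ∧ ∃ n : ℕ, n ≠ 0 ∧ ∀ D : Measure ℝ, IsStandardStable p D → ∀ u : ℝ, 1 ≤ u →
      c / u ^ n ≤ D.real {x | u ≤ |x| ^ p} := by
  obtain ⟨hp1, hp2⟩ := hp
  -- With `t = (2u²)^(-k)`, this `k` gives `t^(2-p) ≤ 1/(2u²)`, so the quadratic term `t² s²/2` is
  -- at most `t^p/4`.
  obtain ⟨k, hk⟩ := exists_nat_ge (1 / (2 - p))
  have hk' : 1 ≤ k * (2 - p) := by rwa [div_le_iff₀ (by linarith)] at hk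
  have hk0 : k ≠ 0 := by rintro rfl; simp at hk'; linarith
  refine ⟨1 / 8 / 2 ^ (2 * k), by positivity, 4 * k, by positivity, fun D hD u hu => ?_⟩
  have := hD.1
  have hu0 : 0 < u := by linarith
  set w : ℝ := 2 * u ^ 2 with hw
  have hw1 : 1 ≤ w := by nlinarith
  have hw0 : 0 < w := by linarith
  set t : ℝ := (w ^ k)⁻¹ with ht
  have ht0 : 0 < t := by positivity
  have ht1 : t ≤ 1 := inv_le_one_of_one_le₀ (one_le_pow₀ hw1)
  set s : ℝ := u ^ p⁻¹ with hs
  have hs0 : 0 < s := by positivity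
  have hsu : s ≤ u := by
    calc s ≤ u ^ (1 : ℝ) := Real.rpow_le_rpow_of_exponent_le hu (inv_le_one_of_one_le₀ hp1.le)
      _ = u := Real.rpow_one u
  have hset : {x : ℝ | u ≤ |x| ^ p} = {x | s ≤ |x|} := by
    ext x
    exact (Real.rpow_inv_le_iff_of_pos hu0.le (abs_nonneg x) (by linarith)).symm
  have hm : MeasurableSet {x : ℝ | s ≤ |x|} := measurableSet_le (by fun_prop) (by fun_prop)
  -- Bound `1 - cos(tx)` by `(tx)²/2` for `|x| < s` and by `2` elsewhere.
  have hup : 1 - Real.exp (-|t| ^ p) ≤ t ^ 2 * s ^ 2 / 2 + 2 * D.real {x | s ≤ |x|} := by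
    rw [← hD.integral_one_sub_cos]
    calc ∫ x, (1 - Real.cos (t * x)) ∂D
        ≤ ∫ x, (t ^ 2 * s ^ 2 / 2 + {x | s ≤ |x|}.indicator (fun _ => (2 : ℝ)) x) ∂D := by
          refine integral_mono
            ((integrable_const _).sub (Integrable.of_bound (C := 1) (by fun_prop)
              (ae_of_all _ fun x => Real.abs_cos_le_one _)))
            ((integrable_const _).add ((integrable_const _).indicator hm)) fun x => ?_
          by_cases hx : s ≤ |x|
          · simp only [Set.indicator, Set.mem_ofPred_eq, hx, if_true]
            have := Real.neg_one_le_cos (t * x)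
            have : 0 ≤ t ^ 2 * s ^ 2 / 2 := by positivity
            linarith
          · simp only [Set.indicator, Set.mem_ofPred_eq, hx, if_false, add_zero]
            have h1 := Real.one_sub_sq_div_two_le_cos (x := t * x)
            have h2 : x ^ 2 ≤ s ^ 2 := sq_le_sq.2 (by rw [abs_of_pos hs0]; exact (not_le.1 hx).le)
            have h3 : t ^ 2 * x ^ 2 ≤ t ^ 2 * s ^ 2 := by gcongr
            rw [mul_pow] at h1
            linarith
      _ = _ := by
          rw [integral_add (integrable_const _) ((integrable_const _).indicator hm),
            integral_indicator hm, setIntegral_const]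
          simp [mul_comm]
  have htp0 : 0 ≤ t ^ p := by positivity
  have htp1 : t ^ p ≤ 1 := Real.rpow_le_one ht0.le ht1 (by linarith)
  have hlow : t ^ p / 2 ≤ 1 - Real.exp (-|t| ^ p) := by
    rw [abs_of_pos ht0]
    have := Real.exp_neg_le_quadratic htp0
    nlinarith
  have htpow : t ^ (2 - p) ≤ w⁻¹ := by
    rw [ht, Real.inv_rpow (by positivity), ← Real.rpow_natCast, ← Real.rpow_mul hw0.le]
    gcongr
    calc w = w ^ (1 : ℝ) := (Real.rpow_one w).symm
      _ ≤ _ := Real.rpow_le_rpow_of_exponent_le hw1 hk'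
  have hsplit : t ^ 2 = t ^ p * t ^ (2 - p) := by
    rw [← Real.rpow_add ht0, ← Real.rpow_natCast]; norm_num
  have hsmall : t ^ 2 * s ^ 2 / 2 ≤ t ^ p / 4 := by
    calc t ^ 2 * s ^ 2 / 2 ≤ t ^ p * w⁻¹ * u ^ 2 / 2 := by rw [hsplit]; gcongr
      _ = t ^ p / 4 := by rw [hw]; field_simp; norm_num
  have ht2 : t ^ 2 ≤ t ^ p := by
    rw [← Real.rpow_natCast]
    exact Real.rpow_le_rpow_of_exponent_ge ht0 ht1 (by push_cast; linarith)
  rw [hset]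
  calc 1 / 8 / 2 ^ (2 * k) / u ^ (4 * k) = t ^ 2 / 8 := by
        have e1 : (2 : ℝ) ^ (2 * k) = (2 ^ k) ^ 2 := by ring
        have e2 : u ^ (4 * k) = ((u ^ 2) ^ k) ^ 2 := by ring
        rw [ht, hw, mul_pow, e1, e2]
        field_simp
    _ ≤ D.real {x | s ≤ |x|} := by linarith

end IsStandardStable

/-! ### Estimates for the Cauchy and Gaussian laws. -/

lemma cauchyMeasure_real_apply {s : Set ℝ} (hs : MeasurableSet s) :
    (cauchyMeasure 0 1).real s = ∫ x in s, Real.pi⁻¹ * (x ^ 2 + 1)⁻¹ := by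
  rw [cauchyMeasure_of_scale_ne_zero _ one_ne_zero, measureReal_def, withDensity_apply _ hs,
    integral_eq_lintegral_of_nonneg_ae (ae_of_all _ fun x => by positivity) (by fun_prop)]
  simp [cauchyPDF, cauchyPDFReal]

lemma integrable_inv_pi_mul_inv_sq_add_one :
    Integrable fun x : ℝ => Real.pi⁻¹ * (x ^ 2 + 1)⁻¹ := by
  simp_rw [add_comm _ (1 : ℝ)]
  exact integrable_inv_one_add_sq.const_mul _

lemma cauchyMeasure_real_abs_lt_le {v : ℝ} (hv : 0 ≤ v) :
    (cauchyMeasure 0 1).real {x | |x| < v} ≤ v := by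
  have hset : {x : ℝ | |x| < v} = Set.Ioo (-v) v := by ext x; simp [abs_lt]
  rw [hset, cauchyMeasure_real_apply measurableSet_Ioo]
  calc ∫ x in Set.Ioo (-v) v, Real.pi⁻¹ * (x ^ 2 + 1)⁻¹
      ≤ ∫ _ in Set.Ioo (-v) v, (1 / 2 : ℝ) := by
        refine setIntegral_mono_on integrable_inv_pi_mul_inv_sq_add_one.integrableOn
          (integrableOn_const (by simp)) measurableSet_Ioo fun x _ => ?_
        have h1 : Real.pi⁻¹ ≤ 1 / 2 := by
          rw [one_div]; exact inv_anti₀ two_pos Real.two_le_pi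
        have h2 : (x ^ 2 + 1)⁻¹ ≤ 1 := inv_le_one_of_one_le₀ (by nlinarith [sq_nonneg x])
        calc Real.pi⁻¹ * (x ^ 2 + 1)⁻¹ ≤ 1 / 2 * 1 := by gcongr
          _ = _ := by ring
    _ = v := by
        rw [setIntegral_const, Real.volume_real_Ioo_of_le (by linarith), smul_eq_mul]; ring

lemma le_cauchyMeasure_real_le_abs {v : ℝ} (hv : 0 ≤ v) :
    v * (Real.pi⁻¹ * ((2 * v) ^ 2 + 1)⁻¹) ≤ (cauchyMeasure 0 1).real {x | v ≤ |x|} := by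
  have hsub : Set.Icc v (2 * v) ⊆ {x : ℝ | v ≤ |x|} := fun x hx => hx.1.trans (le_abs_self x)
  refine le_trans ?_ (measureReal_mono hsub)
  rw [cauchyMeasure_real_apply measurableSet_Icc]
  calc v * (Real.pi⁻¹ * ((2 * v) ^ 2 + 1)⁻¹)
      = ∫ _ in Set.Icc v (2 * v), Real.pi⁻¹ * ((2 * v) ^ 2 + 1)⁻¹ := by
        rw [setIntegral_const, Real.volume_real_Icc_of_le (by linarith), smul_eq_mul]; ring
    _ ≤ _ := by
        refine setIntegral_mono_on (integrableOn_const (by simp))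
          integrable_inv_pi_mul_inv_sq_add_one.integrableOn measurableSet_Icc fun x hx => ?_
        have := hv.trans hx.1
        gcongr
        exact hx.2

/-- Markov's inequality for the moment of order `2n`. The free exponent allows matching the
polynomial lower bound on the stable tail. -/
lemma exists_gaussianReal_real_le_sq_le (n : ℕ) :
    ∃ M : ℝ, 0 < M ∧ ∀ u : ℝ, 0 < u →
      (gaussianReal 0 1).real {x | u ≤ |x| ^ 2} ≤ M / u ^ n := by
  have hint : Integrable (fun x : ℝ => (|x| ^ 2) ^ n) (gaussianReal 0 1) := by
    have h := (memLp_id_gaussianReal (μ := 0) (v := 1) ((2 * n : ℕ) : ℝ≥0)).integrable_norm_pow'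
    simpa [pow_mul] using h
  have h0 : 0 ≤ ∫ x : ℝ, (|x| ^ 2) ^ n ∂(gaussianReal 0 1) :=
    integral_nonneg fun x => by positivity
  refine ⟨1 + ∫ x : ℝ, (|x| ^ 2) ^ n ∂(gaussianReal 0 1), by positivity, fun u hu => ?_⟩
  have h := mul_meas_ge_le_integral_of_nonneg (μ := gaussianReal 0 1)
    (ae_of_all _ fun x : ℝ => by positivity) hint (u ^ n)
  have hsub : {x : ℝ | u ≤ |x| ^ 2} ⊆ {x | u ^ n ≤ (|x| ^ 2) ^ n} :=
    fun x hx => pow_le_pow_left₀ hu.le hx n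
  rw [le_div_iff₀ (by positivity), mul_comm]
  calc u ^ n * (gaussianReal 0 1).real {x | u ≤ |x| ^ 2}
      ≤ u ^ n * (gaussianReal 0 1).real {x | u ^ n ≤ (|x| ^ 2) ^ n} := by
        exact mul_le_mul_of_nonneg_left (measureReal_mono hsub) (by positivity)
    _ ≤ _ := by linarith

/-! ### Tail inequalities for weighted sums of general nonnegative variables. -/

/-- If `Pr[Y ≥ u] ≤ ε / u` for all `u > 0`, then the mean of `Y` truncated at `M` is at most
`1 + ε log M`. -/
lemma integral_min_le_one_add_log {Ω : Type*} [MeasurableSpace Ω] {P : Measure Ω}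
    [IsProbabilityMeasure P] {Y : Ω → ℝ} (hY : AEMeasurable Y P) (hY0 : ∀ ω, 0 ≤ Y ω) {ε : ℝ}
    (htail : ∀ u, 0 < u → P.real {ω | u ≤ Y ω} ≤ ε / u) {M : ℝ} (hM : 1 ≤ M) :
    ∫ ω, min (Y ω) M ∂P ≤ 1 + ε * Real.log M := by
  have hbd : ∀ ω, |min (Y ω) M| ≤ M := fun ω => by
    rw [abs_of_nonneg (le_min (hY0 ω) (by linarith))]; exact min_le_right _ _
  have hint : Integrable (fun ω => min (Y ω) M) P :=
    Integrable.of_bound (hY.min aemeasurable_const).aestronglyMeasurable M (ae_of_all _ hbd)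
  have hM0 : (0 : ℝ) ≤ M := by linarith
  -- Layer-cake formula: the tail is bounded by `1` on `[0, 1]` and by `ε/u` on `[1, M]`.
  rw [hint.integral_eq_integral_Ioc_meas_le
    (ae_of_all _ fun ω => le_min (hY0 ω) hM0) (ae_of_all _ fun ω => min_le_right _ _),
    ← intervalIntegral.integral_of_le hM0]
  set F : ℝ → ℝ := fun u => P.real {ω | u ≤ min (Y ω) M} with hF
  have hanti : Antitone F := fun a b hab =>
    measureReal_mono (μ := P) fun ω (hω : b ≤ min (Y ω) M) => hab.trans hω
  have hFi : ∀ a b : ℝ, IntervalIntegrable F volume a b := fun a b => hanti.intervalIntegrable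
  rw [← intervalIntegral.integral_add_adjacent_intervals (hFi 0 1) (hFi 1 M)]
  have h1 : ∫ u in (0 : ℝ)..1, F u ≤ 1 := by
    calc ∫ u in (0 : ℝ)..1, F u ≤ ∫ _ in (0 : ℝ)..1, (1 : ℝ) :=
          intervalIntegral.integral_mono_on zero_le_one (hFi 0 1) intervalIntegrable_const
            fun u _ => measureReal_le_one
      _ = 1 := by simp
  have hinv : IntervalIntegrable (fun u : ℝ => ε * u⁻¹) volume 1 M :=
    (intervalIntegral.intervalIntegrable_inv (fun u hu => by
      rw [Set.uIcc_of_le hM] at hu; exact (zero_lt_one.trans_le hu.1).ne') continuousOn_id).const_mul ε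
  have h2 : ∫ u in (1 : ℝ)..M, F u ≤ ε * Real.log M := by
    calc ∫ u in (1 : ℝ)..M, F u ≤ ∫ u in (1 : ℝ)..M, ε * u⁻¹ := by
          refine intervalIntegral.integral_mono_on hM (hFi 1 M) hinv fun u hu => ?_
          refine le_trans (measureReal_mono fun ω (hω : u ≤ min (Y ω) M) => ?_) (htail u (by linarith [hu.1]))
          exact le_trans hω (min_le_left _ _)
      _ = _ := by
          rw [intervalIntegral.integral_const_mul,
            integral_inv_of_pos one_pos (by linarith), div_one]
  linarith

/-- Truncate at `M = mt`: some variable exceeds `M` with probability at most `m · ε/M = ε/t`, and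
Markov's inequality handles the truncated sum, whose mean is at most `(∑ γ i)(1 + ε log M)`. Both
steps are insensitive to dependence. -/
lemma measureReal_sum_ge_le {Ω : Type*} [MeasurableSpace Ω] {P : Measure Ω}
    [IsProbabilityMeasure P] {m : ℕ} (hm : 3 ≤ m) {Y : Fin m → Ω → ℝ}
    (hY : ∀ i, AEMeasurable (Y i) P) (hY0 : ∀ i ω, 0 ≤ Y i ω) {ε : ℝ} (hε : ε ≤ 1 / 2)
    (htail : ∀ i, ∀ u, 0 < u → P.real {ω | u ≤ Y i ω} ≤ ε / u) {γ : Fin m → ℝ}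
    (hγ : ∀ i, 0 < γ i) {t : ℝ} (ht : 1 ≤ t) :
    P.real {ω | t * ∑ i, γ i ≤ ∑ i, γ i * Y i ω} ≤ 2 * Real.log (m * t) / t := by
  have hm3 : (3 : ℝ) ≤ m := by exact_mod_cast hm
  have ht0 : 0 < t := by linarith
  set M : ℝ := m * t with hM
  have hM3 : 3 ≤ M := by nlinarith
  have hM0 : 0 < M := by linarith
  have hne : (Finset.univ : Finset (Fin m)).Nonempty := ⟨⟨0, by omega⟩, Finset.mem_univ _⟩
  have hG : 0 < ∑ i, γ i := Finset.sum_pos (fun i _ => hγ i) hne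
  -- Here `m ≥ 3 > e` enters; with `ε ≤ 1/2` it absorbs `1 + ε` into the final `2 log M`.
  have hlog : 1 ≤ Real.log M := by
    rw [Real.le_log_iff_exp_le hM0]
    linarith [Real.exp_one_lt_d9]
  have hsub : {ω | t * ∑ i, γ i ≤ ∑ i, γ i * Y i ω} ⊆
      (⋃ i, {ω | M ≤ Y i ω}) ∪ {ω | t * ∑ i, γ i ≤ ∑ i, γ i * min (Y i ω) M} := by
    intro ω hω
    by_cases h : ∃ i, M ≤ Y i ω
    · exact Or.inl (Set.mem_iUnion.2 h)
    · push Not at h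
      right
      change t * ∑ i, γ i ≤ ∑ i, γ i * min (Y i ω) M
      simp_rw [fun i => min_eq_left (h i).le]
      exact hω
  have hint : ∀ i, Integrable (fun ω => γ i * min (Y i ω) M) P := fun i => by
    refine (Integrable.of_bound ((hY i).min aemeasurable_const).aestronglyMeasurable M
      (ae_of_all _ fun ω => ?_)).const_mul _
    rw [Real.norm_of_nonneg (le_min (hY0 i ω) hM0.le)]
    exact min_le_right _ _
  have hunion : P.real (⋃ i, {ω | M ≤ Y i ω}) ≤ ε / t := by
    calc P.real (⋃ i, {ω | M ≤ Y i ω}) ≤ ∑ i, P.real {ω | M ≤ Y i ω} :=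
          measureReal_iUnion_fintype_le _
      _ ≤ ∑ _i : Fin m, ε / M := Finset.sum_le_sum fun i _ => htail i M hM0
      _ = ε / t := by
          rw [Finset.sum_const, Finset.card_univ, Fintype.card_fin, nsmul_eq_mul, hM]
          field_simp
  have hmarkov : P.real {ω | t * ∑ i, γ i ≤ ∑ i, γ i * min (Y i ω) M} ≤
      (1 + ε * Real.log M) / t := by
    have h := mul_meas_ge_le_integral_of_nonneg (μ := P)
      (f := fun ω => ∑ i, γ i * min (Y i ω) M)
      (ae_of_all _ fun ω => Finset.sum_nonneg fun i _ =>
        mul_nonneg (hγ i).le (le_min (hY0 i ω) hM0.le))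
      (integrable_finsetSum _ fun i _ => hint i) (t * ∑ i, γ i)
    have hE : ∫ ω, ∑ i, γ i * min (Y i ω) M ∂P ≤ (∑ i, γ i) * (1 + ε * Real.log M) := by
      rw [integral_finsetSum _ fun i _ => hint i, Finset.sum_mul]
      refine Finset.sum_le_sum fun i _ => ?_
      rw [integral_const_mul]
      exact mul_le_mul_of_nonneg_left
        (integral_min_le_one_add_log (hY i) (hY0 i) (htail i) (by linarith)) (hγ i).le
    rw [le_div_iff₀ ht0]
    refine le_of_mul_le_mul_left ?_ hG
    calc _ = t * (∑ i, γ i) * P.real {ω | t * ∑ i, γ i ≤ ∑ i, γ i * min (Y i ω) M} := by ring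
      _ ≤ _ := h.trans hE
  calc _ ≤ _ := measureReal_mono hsub
    _ ≤ _ := measureReal_union_le _ _
    _ ≤ ε / t + (1 + ε * Real.log M) / t := add_le_add hunion hmarkov
    _ = (ε + 1 + ε * Real.log M) / t := by ring
    _ ≤ _ := by
      gcongr
      nlinarith

/-- Since `exp(-sZ)` is at most `exp(-2sb)` on an event of probability at least `1/2`, and at most
`1` elsewhere, its mean is at most `(1 + exp(-2sb))/2 ≤ 1 - sb + (sb)²`. -/
lemma mgf_neg_le_of_half_le {Ω : Type*} [MeasurableSpace Ω] {P : Measure Ω}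
    [IsProbabilityMeasure P] {Z : Ω → ℝ} (hZ : AEMeasurable Z P) (hZ0 : ∀ ω, 0 ≤ Z ω) {b : ℝ}
    (hb : 0 ≤ b) (hhalf : 1 / 2 ≤ P.real {ω | 2 * b ≤ Z ω}) {s : ℝ} (hs : 0 ≤ s) :
    mgf Z P (-s) ≤ Real.exp (-(s * b) + (s * b) ^ 2) := by
  have hnull : NullMeasurableSet {ω | 2 * b ≤ Z ω} P :=
    nullMeasurableSet_le aemeasurable_const hZ
  have hle1 : Real.exp (-(s * (2 * b))) ≤ 1 :=
    Real.exp_le_one_iff.2 (neg_nonpos.2 (by positivity))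
  have hind : Integrable ({ω | 2 * b ≤ Z ω}.indicator
      fun _ => 1 - Real.exp (-(s * (2 * b)))) P := (integrable_const _).indicator₀ hnull
  have h1 : mgf Z P (-s) ≤ ∫ ω, (1 - {ω | 2 * b ≤ Z ω}.indicator
      (fun _ => 1 - Real.exp (-(s * (2 * b)))) ω) ∂P := by
    refine integral_mono_of_nonneg (ae_of_all _ fun ω => (Real.exp_pos _).le)
      ((integrable_const _).sub hind) (ae_of_all _ fun ω => ?_)
    by_cases hω : 2 * b ≤ Z ω
    · simp only [Set.indicator, Set.mem_ofPred_eq, hω, if_true, sub_sub_cancel]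
      gcongr
      nlinarith
    · simp only [Set.indicator, Set.mem_ofPred_eq, hω, if_false, sub_zero]
      exact Real.exp_le_one_iff.2 (by nlinarith [mul_nonneg hs (hZ0 ω)])
  rw [integral_sub (integrable_const _) hind, integral_indicator₀ hnull, setIntegral_const] at h1
  simp only [integral_const, probReal_univ, smul_eq_mul, one_mul] at h1
  have h2 := Real.exp_neg_le_quadratic (x := s * (2 * b)) (by positivity)
  have h3 := Real.add_one_le_exp (-(s * b) + (s * b) ^ 2)
  nlinarith

lemma measureReal_sum_le_le_exp {Ω : Type*} [MeasurableSpace Ω] {P : Measure Ω}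
    [IsProbabilityMeasure P] {ι : Type*} [Fintype ι] {Z : ι → Ω → ℝ}
    (hZ : ∀ i, AEMeasurable (Z i) P)
    (hZ0 : ∀ i ω, 0 ≤ Z i ω) (hindep : iIndepFun Z P) {b : ℝ} (hb : 0 < b)
    (hhalf : ∀ i, 1 / 2 ≤ P.real {ω | 2 * b ≤ Z i ω}) {γ : ι → ℝ} (hγ : ∀ i, 0 ≤ γ i)
    {g : ℝ} (hg : 0 < g) (hγg : ∀ i, γ i ≤ g) {t : ℝ} (ht : 0 < t) :
    P.real {ω | ∑ i, γ i * Z i ω ≤ (1 - t) * b * ∑ i, γ i} ≤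
      Real.exp (-((∑ i, γ i) * t ^ 2) / (4 * g)) := by
  -- The Chernoff exponent is at most `(∑ γ i)(-(lb)t + (lb)²g)`, minimized at `lb = t/(2g)`.
  set l : ℝ := t / (2 * g) / b with hl
  have hl0 : 0 < l := by positivity
  have hmeas : ∀ i, AEMeasurable (fun ω => γ i * Z i ω) P := fun i => (hZ i).const_mul _
  have hindep' : iIndepFun (fun i ω => γ i * Z i ω) P :=
    hindep.comp (fun i x => γ i * x) fun i => by fun_prop
  have hsum : (fun ω => ∑ i, γ i * Z i ω) = ∑ i, fun ω => γ i * Z i ω := by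
    ext ω; simp
  have hint : Integrable (fun ω => Real.exp (-l * ∑ i, γ i * Z i ω)) P := by
    refine Integrable.of_bound (C := 1) ?_ (ae_of_all _ fun ω => ?_)
    · exact ((Finset.aemeasurable_fun_sum _ fun i _ => hmeas i).const_mul _).exp.aestronglyMeasurable
    · rw [Real.norm_of_nonneg (Real.exp_pos _).le]
      refine Real.exp_le_one_iff.2 ?_
      rw [neg_mul]
      exact neg_nonpos.2 (mul_nonneg hl0.le
        (Finset.sum_nonneg fun i _ => mul_nonneg (hγ i) (hZ0 i ω)))
  have hmgf : ∀ i, mgf (fun ω => γ i * Z i ω) P (-l) ≤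
      Real.exp (-(l * γ i * b) + (l * γ i * b) ^ 2) := fun i => by
    have h := mgf_neg_le_of_half_le (hZ i) (hZ0 i) hb.le (hhalf i) (s := l * γ i)
      (mul_nonneg hl0.le (hγ i))
    have e : mgf (fun ω => γ i * Z i ω) P (-l) = mgf (Z i) P (-(l * γ i)) := by
      simp only [mgf]; congr 1 with ω; ring_nf
    rwa [e]
  have hch := measure_le_le_exp_mul_mgf (μ := P) ((1 - t) * b * ∑ i, γ i)
    (neg_nonpos.2 hl0.le) hint
  refine hch.trans ?_
  rw [hsum, hindep'.mgf_sum₀ hmeas]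
  calc _ ≤ Real.exp (- -l * ((1 - t) * b * ∑ i, γ i)) *
        ∏ i, Real.exp (-(l * γ i * b) + (l * γ i * b) ^ 2) := by
        gcongr with i
        · exact fun i _ => mgf_nonneg
        · exact hmgf i
    _ = Real.exp (l * ((1 - t) * b * ∑ i, γ i) +
        ∑ i, (-(l * γ i * b) + (l * γ i * b) ^ 2)) := by
        rw [← Real.exp_sum, ← Real.exp_add, neg_neg]
    _ ≤ _ := by
        gcongr
        have hlb : l * b = t / (2 * g) := by rw [hl]; field_simp
        have hb1 : ∑ i, (-(l * γ i * b) + (l * γ i * b) ^ 2) ≤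
            ∑ i, γ i * (-(l * b) + (l * b) ^ 2 * g) := by
          refine Finset.sum_le_sum fun i _ => ?_
          have : (l * b) ^ 2 * (γ i * γ i) ≤ (l * b) ^ 2 * (γ i * g) := by
            have := hγ i
            gcongr
            exact hγg i
          nlinarith
        rw [← Finset.sum_mul] at hb1
        calc _ ≤ l * ((1 - t) * b * ∑ i, γ i) + (∑ i, γ i) * (-(l * b) + (l * b) ^ 2 * g) := by
              gcongr
          _ = (∑ i, γ i) * (-(l * b) * t + (l * b) ^ 2 * g) := by ring
          _ = _ := by rw [hlb]; field_simp; ring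

/-! ### Stochastic comparison, and the tail inequalities for stable variables. -/

lemma stochDominates_map_iff {μ ν : Measure ℝ} [IsProbabilityMeasure μ] [IsProbabilityMeasure ν]
    {f g : ℝ → ℝ} (hf : Measurable f) (hg : Measurable g) :
    StochDominates (μ.map f) (ν.map g) ↔
      ∀ u, ν.real {x | u ≤ g x} ≤ μ.real {x | u ≤ f x} := by
  refine forall_congr' fun u => ?_
  rw [Measure.map_apply hf measurableSet_Ici, Measure.map_apply hg measurableSet_Ici,
    measureReal_def, measureReal_def,
    ENNReal.toReal_le_toReal (measure_ne_top _ _) (measure_ne_top _ _)]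
  rfl

lemma measureReal_le_eq_one_sub {μ : Measure ℝ} [IsProbabilityMeasure μ] {f : ℝ → ℝ}
    (hf : Measurable f) (u : ℝ) : μ.real {x | u ≤ f x} = 1 - μ.real {x | f x < u} := by
  rw [← probReal_compl_eq_one_sub (measurableSet_lt hf measurable_const)]
  congr 1 with x
  simp

namespace IsStandardStable

variable {p : ℝ} {D : Measure ℝ}

lemma measurable_abs_rpow (p : ℝ) : Measurable fun x : ℝ => |x| ^ p := by fun_prop

/-- `|X| ^ p` is stochastically dominated by large multiples of `|C|`, `C` standard Cauchy. -/
lemma exists_stochDominates_cauchy (hp : 1 < p) :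
    ∃ α₀ : ℝ, 0 < α₀ ∧ ∀ α, α₀ ≤ α → ∀ D : Measure ℝ, IsStandardStable p D →
      StochDominates ((cauchyMeasure 0 1).map fun x => α * |x|) (D.map fun x => |x| ^ p) := by
  obtain ⟨c, hc, hball⟩ := exists_le_measureReal_abs_lt (p := p) (by linarith)
  have hpi := Real.pi_pos
  -- With `v = u/α`, the first summand serves the range `v ≤ c`, where small balls are compared, and
  -- the second serves `v > c`, where tails are compared.
  refine ⟨1 / c + 2 * 4 ^ p * Real.pi * (4 + 1 / c ^ 2), by positivity, fun α hα D hD => ?_⟩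
  have := hD.1
  have hα1 : 1 / c ≤ α := le_trans (le_add_of_nonneg_right (by positivity)) hα
  have hα2 : 2 * 4 ^ p * Real.pi * (4 + 1 / c ^ 2) ≤ α :=
    le_trans (le_add_of_nonneg_left (by positivity)) hα
  have hα0 : 0 < α := lt_of_lt_of_le (by positivity) hα1
  rw [stochDominates_map_iff (by fun_prop) (measurable_abs_rpow p)]
  intro u
  rcases le_or_gt u 0 with hu | hu
  · have : {x : ℝ | u ≤ α * |x|} = Set.univ :=
      Set.eq_univ_of_forall fun x => hu.trans (by positivity)
    rw [this, probReal_univ]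
    exact measureReal_le_one
  set v : ℝ := u / α with hv
  have hv0 : 0 < v := by positivity
  have huv : u = v * α := by rw [hv]; field_simp
  rcases le_or_gt v c with hvc | hvc
  · rw [measureReal_le_eq_one_sub (by fun_prop), measureReal_le_eq_one_sub (by fun_prop)]
    have h1 : (cauchyMeasure 0 1).real {x | α * |x| < u} ≤ v := by
      refine le_trans (measureReal_mono fun x (hx : α * |x| < u) => ?_)
        (cauchyMeasure_real_abs_lt_le hv0.le)
      change |x| < v
      rw [hv, lt_div_iff₀ hα0]
      linarith
    have h2 : c * min u 1 ≤ D.real {x | |x| ^ p < u} := by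
      refine (hball D hD (min u 1) (lt_min hu one_pos) (min_le_right _ _)).trans
        (measureReal_mono fun x (hx : |x| < min u 1) => ?_)
      calc |x| ^ p ≤ |x| ^ (1 : ℝ) :=
            Real.rpow_le_rpow_of_exponent_ge' (abs_nonneg x) (lt_min_iff.1 hx).2.le
              zero_le_one hp.le
        _ = |x| := Real.rpow_one _
        _ < u := (lt_min_iff.1 hx).1
    have h3 : v ≤ c * min u 1 := by
      rw [mul_min_of_nonneg _ _ hc.le, mul_one]
      refine le_min ?_ hvc
      rw [div_le_iff₀ hc] at hα1
      rw [huv]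
      nlinarith
    linarith
  · refine (hD.measureReal_le_abs_rpow_le (by linarith) hu).trans ?_
    have hset : {x : ℝ | u ≤ α * |x|} = {x | v ≤ |x|} := by
      ext x
      change u ≤ α * |x| ↔ v ≤ |x|
      rw [hv, div_le_iff₀ hα0, mul_comm]
    rw [hset]
    refine le_trans ?_ (le_cauchyMeasure_real_le_abs hv0.le)
    have h1 : (2 * v) ^ 2 + 1 ≤ v ^ 2 * (4 + 1 / c ^ 2) := by
      have : 1 ≤ v ^ 2 * (1 / c ^ 2) := by
        rw [mul_one_div, one_le_div (by positivity)]
        gcongr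
      linarith
    calc 2 * 4 ^ p / u ≤ v * (Real.pi⁻¹ * (v ^ 2 * (4 + 1 / c ^ 2))⁻¹) := by
          rw [div_le_iff₀ hu, huv]
          have e : v * (Real.pi⁻¹ * (v ^ 2 * (4 + 1 / c ^ 2))⁻¹) * (v * α) =
              α / (Real.pi * (4 + 1 / c ^ 2)) := by field_simp
          rw [e, le_div_iff₀ (by positivity)]
          linarith
      _ ≤ _ := by gcongr

/-- For `u ≤ 1` and `p < 2` one has `u^(1/p) ≤ √u`, the small-ball order of the squared Gaussian. -/
lemma exists_measureReal_abs_rpow_lt_le (hp : p ∈ Set.Ioo (1 : ℝ) 2) :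
    ∃ C : ℝ, 0 < C ∧ ∀ D : Measure ℝ, IsStandardStable p D → ∀ u : ℝ, 0 < u → u ≤ 1 →
      D.real {x | |x| ^ p < u} ≤ C * √u := by
  have hp0 : 0 < p := by linarith [hp.1]
  obtain ⟨C, hC, hball⟩ := exists_measureReal_abs_lt_le hp0
  refine ⟨C, hC, fun D hD u hu hu1 => ?_⟩
  have := hD.1
  refine (measureReal_mono fun x (hx : |x| ^ p < u) => ?_).trans
    (hball D hD (√u) (Real.sqrt_pos.2 hu))
  change |x| < √u
  rw [← Real.lt_rpow_inv_iff_of_pos (abs_nonneg x) hu.le hp0] at hx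
  refine hx.trans_le ?_
  rw [Real.sqrt_eq_rpow, one_div]
  exact Real.rpow_le_rpow_of_exponent_ge hu hu1 (inv_anti₀ hp0 hp.2.le)

/-- `|X| ^ p` stochastically dominates small multiples of `|G| ^ 2`, `G` standard Gaussian. -/
lemma exists_stochDominates_gaussian (hp : p ∈ Set.Ioo (1 : ℝ) 2) :
    ∃ β₀ : ℝ, 0 < β₀ ∧ ∀ β, 0 < β → β ≤ β₀ → ∀ D : Measure ℝ, IsStandardStable p D →
      StochDominates (D.map fun x => |x| ^ p)
        ((gaussianReal 0 1).map fun x => β * |x| ^ 2) := by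
  obtain ⟨C, hC, hball⟩ := exists_measureReal_abs_rpow_lt_le hp
  obtain ⟨a, ha, hG⟩ := exists_le_gaussianReal_real_Ioo
  obtain ⟨c, hc, n, hn, htail⟩ := exists_le_measureReal_le_abs_rpow hp
  obtain ⟨M, hM, hGtail⟩ := exists_gaussianReal_real_le_sq_le n
  set u₁ : ℝ := min 1 ((a / C) ^ 2) with hu₁
  have hu₁0 : 0 < u₁ := lt_min one_pos (by positivity)
  set q : ℝ := min 1 (c / M) with hq
  have hq0 : 0 < q := lt_min one_pos (by positivity)
  have hq1 : q ≤ 1 := min_le_left _ _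
  -- Below `u₁`, small balls are compared, using `C√β ≤ a`. Above `u₁`, tails are compared; there
  -- `q` ensures `M β^n ≤ c u₁^n`.
  refine ⟨u₁ * q, by positivity, fun β hβ hβle D hD => ?_⟩
  have := hD.1
  have hsqrt : ∀ x, x ≤ u₁ → C * √x ≤ a := fun x hx => by
    have : √x ≤ a / C := Real.sqrt_le_iff.2 ⟨by positivity, hx.trans (min_le_right _ _)⟩
    rw [le_div_iff₀ hC] at this
    linarith
  rw [stochDominates_map_iff (measurable_abs_rpow p) (by fun_prop)]
  intro u
  rcases le_or_gt u 0 with hu | hu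
  · have : {x : ℝ | u ≤ |x| ^ p} = Set.univ :=
      Set.eq_univ_of_forall fun x => hu.trans (by positivity)
    rw [this, probReal_univ]
    exact measureReal_le_one
  rcases le_or_gt u u₁ with huu | huu
  · rw [measureReal_le_eq_one_sub (by fun_prop), measureReal_le_eq_one_sub (by fun_prop)]
    have h1 := hball D hD u hu (huu.trans (min_le_left _ _))
    set r : ℝ := min (√(u / β)) 1 with hr
    have h2 : a * r ≤ (gaussianReal 0 1).real {x | β * |x| ^ 2 < u} := by
      have h := hG 1 le_rfl r (by positivity) (min_le_right _ _)
      rw [NNReal.coe_one, Real.sqrt_one, div_one] at h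
      refine h.trans (measureReal_mono fun x hx => ?_)
      have hxr : |x| < √(u / β) := (abs_lt.2 hx).trans_le (min_le_left _ _)
      rw [Real.lt_sqrt (abs_nonneg x), lt_div_iff₀ hβ] at hxr
      change β * |x| ^ 2 < u
      linarith
    have h3 : C * √u ≤ a * r := by
      rw [hr, mul_min_of_nonneg _ _ ha.le, mul_one]
      refine le_min ?_ (hsqrt u huu)
      rw [Real.sqrt_div hu.le, ← mul_div_assoc, le_div_iff₀ (Real.sqrt_pos.2 hβ)]
      have h4 := hsqrt β (hβle.trans (mul_le_of_le_one_right hu₁0.le hq1))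
      nlinarith [Real.sqrt_nonneg u]
    linarith
  -- The stable tail bound needs an argument at least `1`, hence its use at `u/u₁ ≥ u`.
  · have h1 : c / (u / u₁) ^ n ≤ D.real {x | u ≤ |x| ^ p} := by
      refine (htail D hD (u / u₁) ((one_le_div hu₁0).2 huu.le)).trans
        (measureReal_mono fun x (hx : u / u₁ ≤ |x| ^ p) => ?_)
      refine le_trans ?_ hx
      rw [le_div_iff₀ hu₁0]
      exact mul_le_of_le_one_right hu.le (min_le_left _ _)
    have h2 : (gaussianReal 0 1).real {x | u ≤ β * |x| ^ 2} ≤ M / (u / β) ^ n := by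
      refine le_trans (measureReal_mono fun x (hx : u ≤ β * |x| ^ 2) => ?_)
        (hGtail (u / β) (by positivity))
      change u / β ≤ |x| ^ 2
      rw [div_le_iff₀ hβ]
      linarith
    refine h2.trans (le_trans ?_ h1)
    have h3 : M * β ^ n ≤ c * u₁ ^ n := by
      calc M * β ^ n ≤ M * (u₁ * q) ^ n := by gcongr
        _ = M * (u₁ ^ n * q ^ n) := by rw [mul_pow]
        _ ≤ M * (u₁ ^ n * (c / M)) := by
          gcongr
          exact (pow_le_of_le_one hq0.le hq1 hn).trans (min_le_right _ _)
        _ = c * u₁ ^ n := by field_simp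
    rw [div_pow, div_pow, div_div_eq_mul_div, div_div_eq_mul_div]
    gcongr

lemma exists_half_le_measureReal_le_abs_rpow (hp : p ∈ Set.Ioo (1 : ℝ) 2) :
    ∃ β₀ : ℝ, 0 < β₀ ∧ ∀ β, β ≤ β₀ → ∀ D : Measure ℝ, IsStandardStable p D →
      1 / 2 ≤ D.real {x | 2 * β ≤ |x| ^ p} := by
  obtain ⟨C, hC, hball⟩ := exists_measureReal_abs_rpow_lt_le hp
  set u : ℝ := min 1 ((1 / (2 * C)) ^ 2) with hu
  have hu0 : 0 < u := lt_min one_pos (by positivity)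
  refine ⟨u / 2, by positivity, fun β hβ D hD => ?_⟩
  have := hD.1
  have h1 := hball D hD u hu0 (min_le_left _ _)
  have h2 : √u ≤ 1 / (2 * C) := Real.sqrt_le_iff.2 ⟨by positivity, min_le_right _ _⟩
  have h3 : C * √u ≤ 1 / 2 := by
    calc C * √u ≤ C * (1 / (2 * C)) := by gcongr
      _ = 1 / 2 := by field_simp
  have h4 := measureReal_le_eq_one_sub (μ := D) (measurable_abs_rpow p) u
  have h5 : D.real {x | u ≤ |x| ^ p} ≤ D.real {x | 2 * β ≤ |x| ^ p} :=
    measureReal_mono fun x (hx : u ≤ |x| ^ p) => le_trans (by linarith) hx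
  linarith

/-- Upper tail of weighted sums of `p`-th powers of dependent `p`-stable variables. -/
lemma measureReal_sum_abs_rpow_ge_le (hp : 0 < p) (hD : IsStandardStable p D) {α : ℝ}
    (hα0 : 0 < α) (hα : 2 * (2 * 4 ^ p) ≤ α) {Ω : Type*} [MeasurableSpace Ω] {P : Measure Ω}
    [IsProbabilityMeasure P] {m : ℕ} {X : Fin m → Ω → ℝ} {γ : Fin m → ℝ} {t : ℝ} (hm : 3 ≤ m)
    (hX : ∀ i, HasLaw (X i) D P) (hγ : ∀ i, 0 < γ i) (ht : 1 ≤ t) :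
    P.real {ω | t * α * ∑ i, γ i ≤ ∑ i, γ i * |X i ω| ^ p} ≤ 2 * Real.log (m * t) / t := by
  have hε : 2 * 4 ^ p / α ≤ 1 / 2 := by rw [div_le_iff₀ hα0]; linarith
  -- Dividing by `α` turns the stable tail bound into `ε/u` with `ε = 2·4^p/α ≤ 1/2`.
  have h := measureReal_sum_ge_le (P := P) hm (Y := fun i ω => |X i ω| ^ p / α)
    (fun i => ((measurable_abs_rpow p).comp_aemeasurable (hX i).aemeasurable).div_const α)
    (fun i ω => by positivity) hε (fun i u hu => ?_) hγ ht
  · refine le_trans (le_of_eq ?_) h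
    congr 1 with ω
    simp only [Set.mem_ofPred_eq, ← mul_div_assoc]
    rw [← Finset.sum_div, le_div_iff₀ hα0]
    ring_nf
  · have e : {ω | u ≤ |X i ω| ^ p / α} = {ω | u * α ≤ |X i ω| ^ p} := by
      ext ω; exact le_div_iff₀ hα0
    rw [e, (hX i).measureReal_eq (p := fun x => u * α ≤ |x| ^ p)
      (measurableSet_le measurable_const (measurable_abs_rpow p))]
    refine (hD.measureReal_le_abs_rpow_le hp (by positivity)).trans (le_of_eq ?_)
    rw [div_div, mul_comm u]

/-- Lower tail of weighted sums of `p`-th powers of independent `p`-stable variables. -/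
lemma log_measure_sum_abs_rpow_le_le {β : ℝ} (hβ : 0 < β)
    (hhalf : 1 / 2 ≤ D.real {x | 2 * β ≤ |x| ^ p}) {Ω : Type*} [MeasurableSpace Ω]
    {P : Measure Ω} [IsProbabilityMeasure P] {m : ℕ} {X : Fin m → Ω → ℝ} {γ : Fin m → ℝ} {t : ℝ}
    (hX : ∀ i, HasLaw (X i) D P) (hindep : iIndepFun X P) (hγ : ∀ i, 0 ≤ γ i)
    (hγ' : ∃ i, 0 < γ i) (ht : 0 < t) :
    ENNReal.log (P {ω | ∑ i, γ i * |X i ω| ^ p ≤ (1 - t) * β * ∑ i, γ i}) ≤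
      ((-((∑ i, γ i) * t ^ 2) / (6 * ⨆ i, γ i) : ℝ) : EReal) := by
  have hle : ∀ i, γ i ≤ ⨆ i, γ i := fun i => le_ciSup (Set.finite_range γ).bddAbove i
  obtain ⟨j, hj⟩ := hγ'
  have hg : 0 < ⨆ i, γ i := hj.trans_le (hle j)
  have h := measureReal_sum_le_le_exp (P := P) (Z := fun i ω => |X i ω| ^ p)
    (fun i => (measurable_abs_rpow p).comp_aemeasurable (hX i).aemeasurable)
    (fun i ω => by positivity)
    (hindep.comp (fun _ x => |x| ^ p) fun _ => measurable_abs_rpow p) hβ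
    (fun i => by
      rwa [(hX i).measureReal_eq (p := fun x => 2 * β ≤ |x| ^ p)
        (measurableSet_le measurable_const (measurable_abs_rpow p))]) hγ hg hle ht
  -- The Chernoff argument yields the sharper constant `4`, relaxed here to `6`.
  have h2 : Real.exp (-((∑ i, γ i) * t ^ 2) / (4 * ⨆ i, γ i)) ≤
      Real.exp (-((∑ i, γ i) * t ^ 2) / (6 * ⨆ i, γ i)) := by
    have : 0 ≤ (∑ i, γ i) * t ^ 2 :=
      mul_nonneg (Finset.sum_nonneg fun i _ => hγ i) (by positivity)
    rw [Real.exp_le_exp, neg_div, neg_div, neg_le_neg_iff]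
    gcongr
    norm_num
  rw [← ofReal_measureReal]
  calc _ ≤ ENNReal.log (ENNReal.ofReal (Real.exp (-((∑ i, γ i) * t ^ 2) / (6 * ⨆ i, γ i)))) :=
        ENNReal.log_le_log (ENNReal.ofReal_le_ofReal (h.trans h2))
    _ = _ := by rw [ENNReal.log_ofReal_of_pos (Real.exp_pos _), Real.log_exp]

end IsStandardStable

theorem mainTheorem10 (p : ℝ) (hp : p ∈ Set.Ioo (1 : ℝ) 2) :
    ∃ α β : ℝ, 0 < α ∧ 0 < β ∧ ∀ D : Measure ℝ, IsStandardStable p D →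
      -- `α |C| ⪰ |X_p| ^ p`
      StochDominates ((cauchyMeasure 0 1).map fun x => α * |x|) (D.map fun x => |x| ^ p) ∧
      -- `|X_p| ^ p ⪰ β |G| ^ 2`
      StochDominates (D.map fun x => |x| ^ p) ((gaussianReal 0 1).map fun x => β * |x| ^ 2) ∧
      -- upper tail inequality, without independence
      (∀ (Ω : Type*) [MeasurableSpace Ω] (P : Measure Ω) [IsProbabilityMeasure P]
        (m : ℕ) (X : Fin m → Ω → ℝ) (γ : Fin m → ℝ) (t : ℝ),
        3 ≤ m → (∀ i, HasLaw (X i) D P) → (∀ i, 0 < γ i) → 1 ≤ t →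
          P.real {ω | t * α * ∑ i, γ i ≤ ∑ i, γ i * |X i ω| ^ p} ≤
            2 * Real.log (m * t) / t) ∧
      -- lower tail inequality, with independence; here `ENNReal.log 0 = -∞`
      (∀ (Ω : Type*) [MeasurableSpace Ω] (P : Measure Ω) [IsProbabilityMeasure P]
        (m : ℕ) (X : Fin m → Ω → ℝ) (γ : Fin m → ℝ) (t : ℝ),
        (∀ i, HasLaw (X i) D P) → iIndepFun X P → (∀ i, 0 ≤ γ i) → (∃ i, 0 < γ i) → 0 < t →
          ENNReal.log (P {ω | ∑ i, γ i * |X i ω| ^ p ≤ (1 - t) * β * ∑ i, γ i}) ≤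
            ((-((∑ i, γ i) * t ^ 2) / (6 * ⨆ i, γ i) : ℝ) : EReal)) := by

  obtain ⟨α₀, hα₀, hα⟩ := IsStandardStable.exists_stochDominates_cauchy hp.1
  obtain ⟨β₁, hβ₁, hβ⟩ := IsStandardStable.exists_stochDominates_gaussian hp
  obtain ⟨β₂, hβ₂, hhalf⟩ := IsStandardStable.exists_half_le_measureReal_le_abs_rpow hp
  have hp0 : 0 < p := by linarith [hp.1]
  have hα0 : 0 < max α₀ (2 * (2 * 4 ^ p)) := lt_max_of_lt_left hα₀
  have hβ0 : 0 < min β₁ β₂ := lt_min hβ₁ hβ₂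
  -- Each requirement survives increasing `α` or decreasing `β`, so one pair of constants meets them
  -- all.
  exact ⟨max α₀ (2 * (2 * 4 ^ p)), min β₁ β₂, hα0, hβ0, fun D hD =>
    ⟨hα _ (le_max_left _ _) D hD, hβ _ hβ0 (min_le_left _ _) D hD,
      fun Ω _ P _ m X γ t hm hX hγ ht =>
        hD.measureReal_sum_abs_rpow_ge_le hp0 hα0 (le_max_right _ _) hm hX hγ ht,
      fun Ω _ P _ m X γ t hX hindep hγ hγ' ht =>
        IsStandardStable.log_measure_sum_abs_rpow_le_le hβ0 (hhalf _ (min_le_right _ _) D hD)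
          hX hindep hγ hγ' ht⟩⟩
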